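/- Let $P$ be a finite poset on $\{x_1,\dots,x_n\}$, let $k$ be a field, let $S=k[x_1,\dots,x_n]$ be the standard graded polynomial ring whose variables are the elements of $P$, and let $t\ge 2$ be an integer. A path of length $t$ in $P$ is a sequence of $t$ elements of $P$ each of which is covered by the next one, and $I_t(P)\subseteq S$ is the ideal generated by the monomials $x_{i_1}\cdots x_{i_t}$ such that $x_{i_1},\dots,x_{i_t}$ is a path of length $t$ in $P$. Let $a_t(P)$ be the maximal integer $s$ such that there is a set $\{P_1,\dots,P_s\}$ of $s$ pairwise disjoint paths of length $t$ in $P$ such that $\bigcup_{i=1}^s P_i$ contains no path of length $t$ in $P$ other than $P_1,\dots,P_s$. Then $$\operatorname{reg}(S/I_t(P))\ \ge\ a_t(P)\cdot(t-1).$$ Here $\operatorname{reg}(M)=\max\{j-i:\beta_{i,j}(M)\neq 0\}$ is the Castelnuovo–Mumford regularity of a finitely generated graded $S$-module $M$, where the graded Betti number $\beta_{i,j}(M)$ is the number of basis elements of degree $j$ in the $i$-th free module of a minimal graded free resolution of $M$. -/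

import Mathlib

namespace PosetPathIdeal

section Regularity

/-- A minimal graded free resolution
`⋯ → F₂ → F₁ → F₀ → M → 0` of a finitely generated graded module `M` over the standard graded
polynomial ring `S = k[x_v : v ∈ σ]`. Here `𝓜 j` is the homogeneous component of `M` of degree `j`,
and `F i = ⨁_b S(-deg i b)` is free of finite rank with a homogeneous basis whose `b`-th element
has degree `deg i b`. -/
structure MinimalGradedFreeResolution {σ k M : Type*} [Field k] [AddCommGroup M] [Module k M]
    [Module (MvPolynomial σ k) M] (𝓜 : ℕ → Submodule k M) where
  /-- the rank of `F i` -/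
  rank : ℕ → ℕ
  /-- the degrees of the basis elements of `F i` -/
  deg : (i : ℕ) → Fin (rank i) → ℕ
  /-- the differential `F (i + 1) → F i` -/
  d : (i : ℕ) → (Fin (rank (i + 1)) → MvPolynomial σ k) →ₗ[MvPolynomial σ k]
    (Fin (rank i) → MvPolynomial σ k)
  /-- the augmentation `F 0 → M` -/
  aug : (Fin (rank 0) → MvPolynomial σ k) →ₗ[MvPolynomial σ k] M
  /-- The differentials are homogeneous of degree zero: the entry of the matrix of `d i` in row `a`
  and column `b` is homogeneous of degree `deg (i + 1) b - deg i a` (so zero if this is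
  negative). -/
  d_homogeneous : ∀ i a b m, MvPolynomial.coeff m (d i (Pi.single b 1) a) ≠ 0 →
    m.degree + deg i a = deg (i + 1) b
  /-- The augmentation is homogeneous of degree zero. -/
  aug_homogeneous : ∀ b, aug (Pi.single b 1) ∈ 𝓜 (deg 0 b)
  aug_surjective : Function.Surjective aug
  exact_zero : Function.Exact (d 0) aug
  exact_succ : ∀ i, Function.Exact (d (i + 1)) (d i)
  /-- Minimality: the image of `F (i + 1)` lies in `𝔪 F i`, where `𝔪` is the ideal generated by the
  variables, i.e. the ideal of polynomials with constant coefficient zero. -/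
  minimal : ∀ i v a, MvPolynomial.constantCoeff (d i v a) = 0

/-- The graded Betti number `β_{i,j}(M)`: the number of basis elements of degree `j` in the `i`-th
module of a minimal graded free resolution of `M`. Minimal graded free resolutions are unique up to
isomorphism, so all members of the family whose supremum is taken are equal. -/
noncomputable def gradedBetti (σ : Type*) {k M : Type*} [Field k] [AddCommGroup M] [Module k M]
    [Module (MvPolynomial σ k) M] (𝓜 : ℕ → Submodule k M) (i j : ℕ) : ℕ∞ :=
  ⨆ F : MinimalGradedFreeResolution (σ := σ) 𝓜, Set.encard {b | F.deg i b = j}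

/-- The (Castelnuovo–Mumford) regularity `max {j - i | β_{i,j}(M) ≠ 0}`, as an extended real number
(it is `-∞` for the zero module). -/
noncomputable def regularity (σ : Type*) {k M : Type*} [Field k] [AddCommGroup M] [Module k M]
    [Module (MvPolynomial σ k) M] (𝓜 : ℕ → Submodule k M) : EReal :=
  sSup {r | ∃ i j : ℕ, gradedBetti σ 𝓜 i j ≠ 0 ∧ r = (((j : ℝ) - (i : ℝ) : ℝ) : EReal)}

/-- The homogeneous components of `S / I`, for a homogeneous ideal `I` of a polynomial ring `S`:
the images of the homogeneous components of `S`. -/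
noncomputable def quotientGrading {σ k : Type*} [Field k] (I : Ideal (MvPolynomial σ k)) (j : ℕ) :
    Submodule k (MvPolynomial σ k ⧸ I) :=
  (MvPolynomial.homogeneousSubmodule σ k j).map (Ideal.Quotient.mkₐ k I).toLinearMap

/-- The regularity of `S / I` for a homogeneous ideal `I` of a polynomial ring `S`. -/
noncomputable def regQuotient {σ k : Type*} [Field k] (I : Ideal (MvPolynomial σ k)) : EReal :=
  regularity σ (quotientGrading I)

end Regularity

section Paths

/-- A path of length `t` in (the Hasse diagram of) a poset: a sequence of `t` elements
each of which is covered by the next one. -/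
def IsPath {P : Type*} [PartialOrder P] (t : ℕ) (l : List P) : Prop :=
  l.IsChain (· ⋖ ·) ∧ l.length = t

/-- The path ideal `I_t(P)` in the polynomial ring whose variables are the elements of `P`. -/
noncomputable def pathIdeal (k P : Type*) [Field k] [PartialOrder P] (t : ℕ) :
    Ideal (MvPolynomial P k) :=
  Ideal.span {f | ∃ l : List P, IsPath t l ∧ f = (l.map MvPolynomial.X).prod}

/-- `A` is a set of pairwise disjoint paths of length `t` such that the union of their vertex sets
contains no path of length `t` other than those in `A`. -/
def IsAdmissible {P : Type*} [PartialOrder P] (t : ℕ) (A : Finset (List P)) : Prop :=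
  (∀ l ∈ A, IsPath t l) ∧
  (A : Set (List P)).Pairwise List.Disjoint ∧
  ∀ l, IsPath t l → (∀ x ∈ l, ∃ p ∈ A, x ∈ p) → l ∈ A

/-- `a_t(P)`: the largest cardinality of an admissible set of paths of length `t`. -/
noncomputable def maxPaths (P : Type*) [PartialOrder P] (t : ℕ) : ℕ :=
  sSup {s | ∃ A : Finset (List P), IsAdmissible t A ∧ A.card = s}

/-- For a finite poset and `t ≥ 1`, the supremum defining `a_t(P)` is a maximum. -/
theorem isGreatest_maxPaths (P : Type*) [PartialOrder P] [Finite P] (t : ℕ) (ht : 1 ≤ t) :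
    IsGreatest {s | ∃ A : Finset (List P), IsAdmissible t A ∧ A.card = s} (maxPaths P t) := by
  have hne : {s | ∃ A : Finset (List P), IsAdmissible t A ∧ A.card = s}.Nonempty := by
    refine ⟨0, ∅, ⟨by simp, by simp, ?_⟩, by simp⟩
    rintro l ⟨-, hl⟩ hx
    cases l with
    | nil => simp at hl; omega
    | cons x l => simpa using hx x (by simp)
  have hb : BddAbove {s | ∃ A : Finset (List P), IsAdmissible t A ∧ A.card = s} := by
    have hfin : {l : List P | l.length = t}.Finite := List.finite_length_eq P t
    refine ⟨hfin.toFinset.card, ?_⟩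
    rintro s ⟨A, hA, rfl⟩
    exact Finset.card_le_card fun l hl => by simpa using (hA.1 l hl).2
  exact ⟨Nat.sSup_mem hne hb, fun s hs => le_csSup hb hs⟩

end Paths

end PosetPathIdeal

/-!
Let `L 0, …, L (s - 1)` be an admissible set of paths, let `y ^ μ i` be the monomial of `L i`, and let
`F` be a minimal graded free resolution of `S / I` for the path ideal `I`. It suffices that `F s` has
a basis element of degree `s * t`, since `s * t - s = s * (t - 1)`. Restriction to the variables of
the `L i` turns `I` into a complete intersection, resolved by a Koszul complex whose top basis
element has exactly this degree. Restriction of `F` requires a grading by exponents, which `F` need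
not have; instead, the top Koszul class is detected by an explicit extension.

Let `J` be generated by the `y ^ μ i`, the variables outside the `L i` and the squares of all
variables. Admissibility gives `I ≤ J` (`pathIdeal_le_blockIdeal`). The monomials `y ^ μ r`
successively define an exact complex `0 → k → E (s - 1) → ⋯ → E 0 → S / J → 0` of cyclic modules
`E r = S / blockIdeal k μ s r (r + 1)`, with multiplication by `y ^ μ r` as differential. Its
syzygies are the `S / blockIdeal k μ s r r`; exactness is the colon property
`mem_blockIdeal_of_monomial_mul_mem` together with `modMonomial_mem_blockIdeal`.

The projection `S / I → S / J` lifts to a chain map `F → E`, and `S → S / I` to a chain map from the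
Koszul complex `K` of the `y ^ μ i` to `F`. The composite `K → E` is homotopic to the chain map
that, in each degree `r`, sends `e_{0, …, r - 1}` to `1` and the other basis elements to `0`
(`exists_functional`). In degree `s`, where `E s = k`, homotopic maps agree because the differential
of `K` vanishes modulo the variables. So the homogeneous functional `F s → k` is nonzero, and the
basis element on which it is nonzero has degree `s * t` (`exists_deg_eq`).

As the Betti numbers are defined through minimal graded free resolutions, one has to exist. It is
built by covering each syzygy module by a shortest system of homogeneous generators, which is minimal
by the graded Nakayama lemma (`exists_minimal_homogeneous_generators`,
`exists_minimalGradedFreeResolution`).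
-/

namespace PosetPathIdeal

open MvPolynomial

/-! ### Graded free modules over a polynomial ring -/

section GradedFree

variable {σ k ι : Type*} [Field k]

/-- The part of degree `j` of an element of the shifted polynomial ring `S(-d)`, that is, the
homogeneous component of degree `j - d` (which is zero if `j < d`). -/
noncomputable def shiftedComponent (d j : ℕ) :
    MvPolynomial σ k →ₗ[k] MvPolynomial σ k :=
  if d ≤ j then homogeneousComponent (j - d) else 0

lemma coeff_shiftedComponent (d j : ℕ) (f : MvPolynomial σ k) (m : σ →₀ ℕ) :
    coeff m (shiftedComponent d j f) = if m.degree + d = j then coeff m f else 0 := by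
  unfold shiftedComponent
  split_ifs with h h' h'
  · rw [coeff_homogeneousComponent, if_pos (by omega)]
  · rw [coeff_homogeneousComponent, if_neg (by omega)]
  · omega
  · simp

/-- The part of degree `j` of an element of the graded free module `⨁_a S(-deg a)`. -/
noncomputable def vectorComponent (deg : ι → ℕ) (j : ℕ) (v : ι → MvPolynomial σ k) :
    ι → MvPolynomial σ k :=
  fun a => shiftedComponent (deg a) j (v a)

/-- The element `v` of `⨁_a S(-deg a)` is homogeneous of degree `D`. -/
def IsHomogeneousVector (deg : ι → ℕ) (D : ℕ) (v : ι → MvPolynomial σ k) : Prop :=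
  ∀ a m, coeff m (v a) ≠ 0 → m.degree + deg a = D

/-- A submodule of the graded free module `⨁_a S(-deg a)` is graded if it contains the homogeneous
components of each of its elements. -/
def IsGradedSubmodule (deg : ι → ℕ) (N : Submodule (MvPolynomial σ k) (ι → MvPolynomial σ k)) :
    Prop :=
  ∀ v ∈ N, ∀ j, vectorComponent deg j v ∈ N

lemma isHomogeneousVector_vectorComponent (deg : ι → ℕ) (j : ℕ) (v : ι → MvPolynomial σ k) :
    IsHomogeneousVector deg j (vectorComponent deg j v) := by
  intro a m h
  rw [vectorComponent, coeff_shiftedComponent] at h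
  by_contra hne
  simp [hne] at h

lemma vectorComponent_smul {deg : ι → ℕ} {D : ℕ} {e : ι → MvPolynomial σ k}
    (he : IsHomogeneousVector deg D e) (j : ℕ) (c : MvPolynomial σ k) :
    vectorComponent deg j (c • e) = shiftedComponent D j c • e := by
  classical
  funext a
  ext m
  simp only [vectorComponent, coeff_shiftedComponent, Pi.smul_apply, smul_eq_mul, coeff_mul]
  have key : ∀ x ∈ Finset.HasAntidiagonal.antidiagonal m,
      (ite (x.1.degree + D = j) (coeff x.1 c) 0) * coeff x.2 (e a) =
        if m.degree + deg a = j then coeff x.1 c * coeff x.2 (e a) else 0 := by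
    intro x hx
    rw [Finset.HasAntidiagonal.mem_antidiagonal] at hx
    by_cases h0 : coeff x.2 (e a) = 0
    · simp [h0]
    have h1 := he a x.2 h0
    have h2 : m.degree = x.1.degree + x.2.degree := by rw [← hx, map_add]
    by_cases h3 : x.1.degree + D = j
    · rw [if_pos h3, if_pos (by omega)]
    · rw [if_neg h3, if_neg (by omega), zero_mul]
  rw [Finset.sum_congr rfl key]
  split_ifs <;> simp

lemma vectorComponent_sum {κ : Type*} (deg : ι → ℕ) (j : ℕ) (s : Finset κ)
    (v : κ → ι → MvPolynomial σ k) :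
    vectorComponent deg j (∑ b ∈ s, v b) = ∑ b ∈ s, vectorComponent deg j (v b) := by
  funext a
  simp [vectorComponent, Finset.sum_apply, map_sum]

lemma exists_sum_vectorComponent [Fintype ι] (deg : ι → ℕ) (v : ι → MvPolynomial σ k) :
    ∃ B, v = ∑ j ∈ Finset.range B, vectorComponent deg j v := by
  classical
  refine ⟨(∑ a, ((v a).totalDegree + deg a)) + 1, ?_⟩
  funext a
  ext m
  simp only [Finset.sum_apply, coeff_sum, vectorComponent, coeff_shiftedComponent]
  rw [Finset.sum_ite_eq]
  split_ifs with h
  · rfl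
  · by_contra h0
    have h1 : m.degree ≤ (v a).totalDegree := le_totalDegree (mem_support_iff.2 h0)
    have h2 : (v a).totalDegree + deg a ≤ ∑ a, ((v a).totalDegree + deg a) :=
      Finset.single_le_sum (f := fun a => (v a).totalDegree + deg a)
        (fun _ _ => Nat.zero_le _) (Finset.mem_univ a)
    simp at h
    omega

/-- A graded submodule of a graded free module of finite rank is generated by finitely many
homogeneous elements. -/
lemma exists_homogeneous_generators [Finite σ] [Fintype ι] {deg : ι → ℕ}
    {N : Submodule (MvPolynomial σ k) (ι → MvPolynomial σ k)} (hN : IsGradedSubmodule deg N) :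
    ∃ (n : ℕ) (D : Fin n → ℕ) (e : Fin n → ι → MvPolynomial σ k),
      (∀ b, IsHomogeneousVector deg (D b) (e b)) ∧
        Submodule.span (MvPolynomial σ k) (Set.range e) = N := by
  classical
  obtain ⟨G, hG⟩ := (IsNoetherian.noetherian N : N.FG)
  choose B hB using exists_sum_vectorComponent (k := k) (σ := σ) deg
  let G' : Finset (ℕ × (ι → MvPolynomial σ k)) :=
    G.biUnion fun v => (Finset.range (B v)).image fun j => (j, vectorComponent deg j v)
  let eq := G'.equivFin.symm
  have hmem : ∀ x ∈ G', IsHomogeneousVector deg x.1 x.2 ∧ x.2 ∈ N := by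
    intro x hx
    simp only [G', Finset.mem_biUnion, Finset.mem_image] at hx
    obtain ⟨v, hv, j, -, rfl⟩ := hx
    exact ⟨isHomogeneousVector_vectorComponent deg j v,
      hN v (hG ▸ Submodule.subset_span hv) j⟩
  refine ⟨G'.card, fun b => (eq b).1.1, fun b => (eq b).1.2,
    fun b => (hmem _ (eq b).2).1, le_antisymm ?_ ?_⟩
  · rw [Submodule.span_le]
    rintro _ ⟨b, rfl⟩
    exact (hmem _ (eq b).2).2
  · rw [← hG, Submodule.span_le]
    intro v hv
    rw [hB v]
    refine Submodule.sum_mem _ fun j hj => Submodule.subset_span ?_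
    have hx : (j, vectorComponent deg j v) ∈ G' := by
      simp only [G', Finset.mem_biUnion, Finset.mem_image]
      exact ⟨v, hv, j, hj, rfl⟩
    exact ⟨eq.symm ⟨_, hx⟩, by simp⟩

/-- The graded form of Nakayama's lemma: a shortest homogeneous generating system is minimal, in the
sense that no relation between its members has a coefficient with nonzero constant term. -/
lemma exists_minimal_homogeneous_generators [Finite σ] [Fintype ι] {deg : ι → ℕ}
    {N : Submodule (MvPolynomial σ k) (ι → MvPolynomial σ k)} (hN : IsGradedSubmodule deg N) :
    ∃ (n : ℕ) (D : Fin n → ℕ) (e : Fin n → ι → MvPolynomial σ k),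
      (∀ b, IsHomogeneousVector deg (D b) (e b)) ∧
        Submodule.span (MvPolynomial σ k) (Set.range e) = N ∧
        ∀ c : Fin n → MvPolynomial σ k, ∑ b, c b • e b = 0 → ∀ b, constantCoeff (c b) = 0 := by
  classical
  have hex := exists_homogeneous_generators hN
  obtain ⟨D, e, he, hspan⟩ := Nat.find_spec hex
  have hmin : ∀ n < Nat.find hex, _ := fun n hn => Nat.find_min hex hn
  generalize Nat.find hex = n at D e he hspan hmin
  refine ⟨n, D, e, he, hspan, fun c hc b => ?_⟩
  by_contra hb
  obtain _ | n := n
  · exact b.elim0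
  refine hmin n n.lt_succ_self ⟨fun i => D (b.succAbove i), fun i => e (b.succAbove i),
    fun i => he _, ?_⟩
  -- In degree `D b` the relation expresses `e b` through the other generators.
  have h1 : ∑ i, shiftedComponent (D i) (D b) (c i) • e i = 0 := by
    have := congrArg (vectorComponent deg (D b)) hc
    rw [vectorComponent_sum] at this
    simp only [vectorComponent_smul (he _)] at this
    rw [this]
    funext a
    simp [vectorComponent]
  have h2 : shiftedComponent (D b) (D b) (c b) = C (constantCoeff (c b)) := by
    simp [shiftedComponent, homogeneousComponent_zero, constantCoeff_eq]
  rw [Fin.sum_univ_succAbove _ b, h2] at h1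
  have h3 : e b ∈ Submodule.span (MvPolynomial σ k)
      (Set.range fun i => e (b.succAbove i)) := by
    have h4 : e b = (C (constantCoeff (c b))⁻¹ : MvPolynomial σ k) •
        ((C (constantCoeff (c b)) : MvPolynomial σ k) • e b) := by
      rw [smul_smul, ← C_mul, inv_mul_cancel₀ hb, C_1, one_smul]
    rw [h4, eq_neg_of_add_eq_zero_left h1]
    exact Submodule.smul_mem _ _ (Submodule.neg_mem _ (Submodule.sum_mem _ fun i _ =>
      Submodule.smul_mem _ _ (Submodule.subset_span ⟨i, rfl⟩)))
  rw [← hspan]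
  refine le_antisymm (Submodule.span_mono ?_) (Submodule.span_le.2 ?_)
  · rintro _ ⟨i, rfl⟩
    exact ⟨_, rfl⟩
  · rintro _ ⟨i, rfl⟩
    obtain rfl | ⟨i, rfl⟩ := Fin.eq_self_or_eq_succAbove b i
    · exact h3
    · exact Submodule.subset_span ⟨i, rfl⟩

/-- The relations between homogeneous elements form a graded submodule. -/
lemma isGradedSubmodule_ker {n : ℕ} {deg : ι → ℕ} {D : Fin n → ℕ}
    {e : Fin n → ι → MvPolynomial σ k} (he : ∀ b, IsHomogeneousVector deg (D b) (e b)) :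
    IsGradedSubmodule D (LinearMap.ker (Fintype.linearCombination (MvPolynomial σ k) e)) := by
  intro c hc j
  rw [LinearMap.mem_ker, Fintype.linearCombination_apply] at hc ⊢
  have := congrArg (vectorComponent deg j) hc
  rw [vectorComponent_sum] at this
  simp only [vectorComponent_smul (he _)] at this
  rw [show vectorComponent deg j (0 : ι → MvPolynomial σ k) = 0 by
    funext a; simp [vectorComponent]] at this
  exact this

end GradedFree

/-! ### Existence of minimal graded free resolutions -/

section Existence

variable {σ k : Type*} [Field k]

/-- A graded submodule, contained in `𝔪 F`, of a graded free module `F` of finite rank. These are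
the syzygy modules that arise in the construction of a minimal graded free resolution. -/
structure SyzygyData (σ k : Type*) [Field k] where
  /-- the rank of the ambient free module -/
  rank : ℕ
  /-- the degrees of the basis of the ambient free module -/
  deg : Fin rank → ℕ
  /-- the syzygy module -/
  N : Submodule (MvPolynomial σ k) (Fin rank → MvPolynomial σ k)
  graded : IsGradedSubmodule deg N
  minimal : ∀ v ∈ N, ∀ a, constantCoeff (v a) = 0

/-- Each syzygy module is covered by a graded free module, in such a way that the kernel of the
covering is again a syzygy module. -/
lemma SyzygyData.exists_next [Finite σ] (A : SyzygyData σ k) :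
    ∃ (B : SyzygyData σ k) (d : (Fin B.rank → MvPolynomial σ k) →ₗ[MvPolynomial σ k]
      (Fin A.rank → MvPolynomial σ k)),
      (∀ b, IsHomogeneousVector A.deg (B.deg b) (d (Pi.single b 1))) ∧
        LinearMap.range d = A.N ∧ LinearMap.ker d = B.N := by
  obtain ⟨n, D, e, he, hspan, hmin⟩ := exists_minimal_homogeneous_generators A.graded
  refine ⟨⟨n, D, _, isGradedSubmodule_ker he, fun c hc => hmin c ?_⟩,
    Fintype.linearCombination (MvPolynomial σ k) e, fun b => ?_, ?_, rfl⟩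
  · simpa [Fintype.linearCombination_apply] using hc
  · simpa [Fintype.linearCombination_apply_single] using he b
  · rw [Fintype.range_linearCombination, hspan]

/-- A proper homogeneous ideal `I` of a polynomial ring `S` in finitely many variables: the quotient
`S / I` has a minimal graded free resolution. -/
theorem exists_minimalGradedFreeResolution [Finite σ] {I : Ideal (MvPolynomial σ k)}
    (hI : ∀ f ∈ I, ∀ j, homogeneousComponent j f ∈ I)
    (hI' : ∀ f ∈ I, constantCoeff f = 0) :
    Nonempty (MinimalGradedFreeResolution (σ := σ) (quotientGrading I)) := by
  let A₀ : SyzygyData σ k :=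
    { rank := 1
      deg := fun _ => 0
      N := Submodule.comap (LinearMap.proj 0) I
      graded := fun v hv j => by
        simpa [vectorComponent, shiftedComponent] using hI _ hv j
      minimal := fun v hv a => by
        rw [Subsingleton.elim a 0]
        exact hI' _ hv }
  choose next d hd hrange hker using SyzygyData.exists_next (σ := σ) (k := k)
  let A : ℕ → SyzygyData σ k := fun i => Nat.rec A₀ (fun _ B => next B) i
  refine ⟨{
    rank := fun i => (A i).rank
    deg := fun i => (A i).deg
    d := fun i => d (A i)
    aug := (Submodule.mkQ I).comp
      (LinearMap.proj (R := MvPolynomial σ k) (φ := fun _ : Fin 1 => MvPolynomial σ k) 0)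
    d_homogeneous := fun i a b m h => hd (A i) b a m h
    aug_homogeneous := fun b => ?_
    aug_surjective := ?_
    exact_zero := ?_
    exact_succ := fun i => ?_
    minimal := fun i v a => (A i).minimal _ (hrange (A i) ▸ LinearMap.mem_range_self _ v) a }⟩
  · refine ⟨1, ?_, ?_⟩
    · exact isHomogeneous_one σ k
    · have : b = (0 : Fin 1) := Subsingleton.elim (α := Fin 1) _ _
      subst this
      simp
  · exact (Submodule.mkQ_surjective I).comp fun f => ⟨fun _ => f, rfl⟩
  · rw [LinearMap.exact_iff, LinearMap.ker_comp, Submodule.ker_mkQ]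
    exact (hrange A₀).symm
  · rw [LinearMap.exact_iff]
    exact (hker (A i)).trans (hrange (A (i + 1))).symm

end Existence

/-! ### The signed boundary of the Koszul complex -/

section Koszul

variable {R M M' : Type*} [CommRing R] [AddCommGroup M] [Module R M] [AddCommGroup M'] [Module R M']

/-- The Koszul boundary of a family `w` indexed by finite sets: the image of the basis element `e_T`
under the Koszul differential of the elements `x i`, with `w U` substituted for `e_U`. The sign
counts the elements of `T` that are larger than the one removed, so that the largest one is removed
with sign `1`. -/
def koszulBoundary (x : ℕ → R) (w : Finset ℕ → M) (T : Finset ℕ) : M :=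
  ∑ i ∈ T, ((-1) ^ (T.filter (i < ·)).card * x i) • w (T.erase i)

lemma map_koszulBoundary (f : M →ₗ[R] M') (x : ℕ → R) (w : Finset ℕ → M) (T : Finset ℕ) :
    f (koszulBoundary x w T) = koszulBoundary x (fun U => f (w U)) T := by
  simp [koszulBoundary, map_sum]

lemma koszulBoundary_congr (x : ℕ → R) {w w' : Finset ℕ → M} {T : Finset ℕ}
    (h : ∀ i ∈ T, w (T.erase i) = w' (T.erase i)) :
    koszulBoundary x w T = koszulBoundary x w' T :=
  Finset.sum_congr rfl fun i hi => by rw [h i hi]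

lemma koszulBoundary_add (x : ℕ → R) (w w' : Finset ℕ → M) (T : Finset ℕ) :
    koszulBoundary x (fun U => w U + w' U) T =
      koszulBoundary x w T + koszulBoundary x w' T := by
  simp [koszulBoundary, smul_add, Finset.sum_add_distrib]

/-- The signs with which two elements are removed in the two possible orders are opposite. -/
lemma koszul_sign {T : Finset ℕ} {i j : ℕ} (hj : j ∈ T) (hij : i < j) :
    (-1 : R) ^ (T.filter (i < ·)).card * (-1) ^ ((T.erase i).filter (j < ·)).card =
      -((-1) ^ (T.filter (j < ·)).card * (-1) ^ ((T.erase j).filter (i < ·)).card) := by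
  have h1 : (T.erase i).filter (j < ·) = T.filter (j < ·) := by
    ext a
    simp only [Finset.mem_filter, Finset.mem_erase]
    constructor
    · rintro ⟨⟨_, h⟩, h'⟩
      exact ⟨h, h'⟩
    · rintro ⟨h, h'⟩
      exact ⟨⟨by omega, h⟩, h'⟩
  have h2 : (T.filter (i < ·)).card = ((T.erase j).filter (i < ·)).card + 1 := by
    rw [Finset.filter_erase, Finset.card_erase_add_one]
    simp [hj, hij]
  rw [h1, h2, pow_succ]
  ring

lemma koszulBoundary_koszulBoundary (x : ℕ → R) (w : Finset ℕ → M) (T : Finset ℕ) :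
    koszulBoundary x (koszulBoundary x w) T = 0 := by
  simp only [koszulBoundary, Finset.smul_sum, smul_smul]
  rw [Finset.sum_sigma']
  refine Finset.sum_involution (fun p _ => ⟨p.2, p.1⟩) ?_ ?_ ?_ ?_
  · rintro ⟨i, j⟩ h
    simp only [Finset.mem_sigma, Finset.mem_erase] at h
    obtain ⟨hi, hne, hj⟩ := h
    rw [Finset.erase_right_comm (a := j), ← add_smul]
    convert zero_smul R _
    obtain h | h := lt_or_gt_of_ne hne
    · linear_combination (x i * x j) * koszul_sign (R := R) hi h
    · linear_combination (x i * x j) * koszul_sign (R := R) hj h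
  · rintro ⟨i, j⟩ h - h'
    simp only [Finset.mem_sigma, Finset.mem_erase] at h
    simp only [Sigma.mk.injEq] at h'
    exact h.2.1 h'.1
  · rintro ⟨i, j⟩ h
    simp only [Finset.mem_sigma, Finset.mem_erase] at h ⊢
    exact ⟨h.2.2, h.2.1.symm, h.1⟩
  · rintro ⟨i, j⟩ h
    rfl

lemma koszulBoundary_mem {N : Submodule R M} (x : ℕ → R) {w : Finset ℕ → M} {T : Finset ℕ}
    (h : ∀ i ∈ T, w (T.erase i) ∈ N) : koszulBoundary x w T ∈ N :=
  Submodule.sum_mem _ fun i hi => N.smul_mem _ (h i hi)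

/-- The functional dual to `e_{0, …, r - 1}`, composed with the Koszul differential, is `x r` times
the functional dual to `e_{0, …, r}`, up to multiples of the `x i` with `r < i`. -/
lemma koszulBoundary_indicator_sub_mem {J : Ideal R} {x : ℕ → R} {r : ℕ} {T : Finset ℕ}
    (hx : ∀ i ∈ T, r < i → x i ∈ J) :
    koszulBoundary x (fun U => if U = Finset.range r then (1 : R) else 0) T -
      x r * (if T = Finset.range (r + 1) then 1 else 0) ∈ J := by
  by_cases hT : T = Finset.range (r + 1)
  · subst hT
    convert J.zero_mem
    rw [koszulBoundary, Finset.sum_eq_single r]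
    · have h1 : (Finset.range (r + 1)).erase r = Finset.range r := by
        ext a
        simp only [Finset.mem_erase, Finset.mem_range]
        omega
      have h2 : (Finset.range (r + 1)).filter (r < ·) = ∅ := by
        ext a
        simp only [Finset.mem_filter, Finset.mem_range, Finset.notMem_empty, iff_false]
        omega
      simp [h1, h2]
    · intro i hi hne
      rw [if_neg, smul_zero]
      intro h
      have : r ∈ (Finset.range (r + 1)).erase i := by simp [hne.symm]
      simp [h] at this
    · simp
  · rw [if_neg hT, mul_zero, sub_zero]
    refine Ideal.sum_mem _ fun i hi => ?_
    dsimp only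
    split_ifs with h
    · have h1 : i ∉ Finset.range r := h ▸ Finset.notMem_erase i T
      have h2 : i ≠ r := by
        rintro rfl
        exact hT (by rw [Finset.range_add_one, ← h, Finset.insert_erase hi])
      rw [Finset.mem_range] at h1
      rw [smul_eq_mul, mul_one]
      exact J.mul_mem_left _ (hx i hi (by omega))
    · simp

end Koszul

/-! ### Monomial ideals given by their exponents -/

section Exponents

variable {σ k : Type*} [Field k]

/-- The monomial ideal of all polynomials whose exponents lie in an upward closed set `U`. -/
def exponentIdeal (k : Type*) [Field k] (U : Set (σ →₀ ℕ)) (hU : IsUpperSet U) :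
    Ideal (MvPolynomial σ k) where
  carrier := {f | ∀ m, coeff m f ≠ 0 → m ∈ U}
  add_mem' {f g} hf hg m hm := by
    by_cases h : coeff m f = 0
    · exact hg m fun h' => hm (by simp [h, h'])
    · exact hf m h
  zero_mem' m hm := by simp at hm
  smul_mem' c f hf m hm := by
    classical
    rw [smul_eq_mul, coeff_mul] at hm
    obtain ⟨p, hp, h⟩ := Finset.exists_ne_zero_of_sum_ne_zero hm
    rw [Finset.HasAntidiagonal.mem_antidiagonal] at hp
    exact hU (hp ▸ le_add_self) (hf p.2 (right_ne_zero_of_mul h))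

lemma monomial_mem_exponentIdeal {U : Set (σ →₀ ℕ)} {hU : IsUpperSet U} {m : σ →₀ ℕ} (h : m ∈ U)
    (a : k) : monomial m a ∈ exponentIdeal k U hU := by
  classical
  intro m' hm'
  rw [coeff_monomial] at hm'
  split_ifs at hm' with h'
  · exact h' ▸ h
  · exact absurd rfl hm'

/-- The exponents of the monomials that lie in the ideal generated by the variables `y v` with `v` outside the
supports of `μ r, …, μ (s - 1)`, all squares `(y v) ^ 2`, and the monomials with exponents
`μ q, …, μ (s - 1)`. -/
def blockExponents (μ : ℕ → σ →₀ ℕ) (s r q : ℕ) : Set (σ →₀ ℕ) :=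
  {m | (∃ v, (∀ i, r ≤ i → i < s → μ i v = 0) ∧ 1 ≤ m v) ∨ (∃ v, 2 ≤ m v) ∨
    ∃ i, q ≤ i ∧ i < s ∧ μ i ≤ m}

lemma isUpperSet_blockExponents (μ : ℕ → σ →₀ ℕ) (s r q : ℕ) :
    IsUpperSet (blockExponents μ s r q) := by
  rintro m m' hle (⟨v, h, h'⟩ | ⟨v, h⟩ | ⟨i, h, h', h''⟩)
  · exact Or.inl ⟨v, h, h'.trans (hle v)⟩
  · exact Or.inr (Or.inl ⟨v, h.trans (hle v)⟩)
  · exact Or.inr (Or.inr ⟨i, h, h', h''.trans hle⟩)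

/-- The monomial ideal with exponents `blockExponents μ s r q`. For `q = r` and `q = r + 1` the
quotients by these ideals are the syzygies and the terms of an exact complex of cyclic modules, from
the residue field (the syzygy for `r = s`) to a quotient of `S / (y ^ μ 0, …, y ^ μ (s - 1))`. -/
def blockIdeal (k : Type*) [Field k] (μ : ℕ → σ →₀ ℕ) (s r q : ℕ) : Ideal (MvPolynomial σ k) :=
  exponentIdeal k _ (isUpperSet_blockExponents μ s r q)

lemma monomial_mem_blockIdeal (μ : ℕ → σ →₀ ℕ) {s r q i : ℕ} (hq : q ≤ i) (hi : i < s) :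
    monomial (μ i) (1 : k) ∈ blockIdeal k μ s r q :=
  monomial_mem_exponentIdeal (Or.inr (Or.inr ⟨i, hq, hi, le_rfl⟩)) 1

/-- Dividing an element of `blockIdeal k μ s r r` by the generator with exponent `μ r` leaves a
remainder in the ideal generated by the other generators. -/
lemma modMonomial_mem_blockIdeal {μ : ℕ → σ →₀ ℕ} {s r : ℕ} {f : MvPolynomial σ k}
    (hf : f ∈ blockIdeal k μ s r r) : f.modMonomial (μ r) ∈ blockIdeal k μ s r (r + 1) := by
  intro m hm
  have hle : ¬ μ r ≤ m := fun h => hm (coeff_modMonomial_of_le _ h)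
  rw [coeff_modMonomial_of_not_le _ hle] at hm
  obtain h | h | ⟨i, h, h', h''⟩ := hf m hm
  · exact Or.inl h
  · exact Or.inr (Or.inl h)
  · refine Or.inr (Or.inr ⟨i, ?_, h', h''⟩)
    obtain rfl | h := h.eq_or_lt
    · exact absurd h'' hle
    · exact h

/-- For squarefree monomials in disjoint sets of variables, the colon ideal of
`blockIdeal k μ s r (r + 1)` by the monomial with exponent `μ r` is contained in
`blockIdeal k μ s (r + 1) (r + 1)`. -/
lemma mem_blockIdeal_of_monomial_mul_mem {μ : ℕ → σ →₀ ℕ} {s r : ℕ}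
    (hsq : ∀ i < s, ∀ v, μ i v ≤ 1)
    (hdisj : ∀ i < s, ∀ j < s, i ≠ j → ∀ v, μ i v = 0 ∨ μ j v = 0) (hr : r < s)
    {f : MvPolynomial σ k} (hf : monomial (μ r) 1 * f ∈ blockIdeal k μ s r (r + 1)) :
    f ∈ blockIdeal k μ s (r + 1) (r + 1) := by
  intro m hm
  have hmem : μ r + m ∈ blockExponents μ s r (r + 1) := hf _ (by rwa [coeff_monomial_mul, one_mul])
  -- A variable dividing the monomial with exponent `μ r` does not occur in the later ones.
  have hlater : ∀ v, μ r v ≠ 0 → ∀ i, r + 1 ≤ i → i < s → μ i v = 0 := fun v hv i hi hi' =>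
    (hdisj r hr i hi' (by omega) v).resolve_left hv
  obtain ⟨v, h, h'⟩ | ⟨v, h⟩ | ⟨i, h, h', h''⟩ := hmem
  · refine Or.inl ⟨v, fun i hi => h i (by omega), ?_⟩
    have := h r le_rfl hr
    simp only [Finsupp.add_apply] at h'
    omega
  · simp only [Finsupp.add_apply] at h
    have h1 := hsq r hr v
    by_cases h0 : μ r v = 0
    · exact Or.inr (Or.inl ⟨v, by omega⟩)
    · exact Or.inl ⟨v, hlater v h0, by omega⟩
  · refine Or.inr (Or.inr ⟨i, h, h', fun v => ?_⟩)
    by_cases h0 : μ r v = 0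
    · have := h'' v
      simp only [Finsupp.add_apply] at this
      omega
    · rw [hlater v h0 i h h']
      exact Nat.zero_le _

/-- The last of the block ideals is contained in the maximal ideal generated by the variables. -/
lemma constantCoeff_eq_zero_of_mem_blockIdeal {μ : ℕ → σ →₀ ℕ} {s : ℕ} {f : MvPolynomial σ k}
    (hf : f ∈ blockIdeal k μ s s s) : constantCoeff f = 0 := by
  by_contra h
  rw [constantCoeff_eq] at h
  obtain ⟨v, -, h'⟩ | ⟨v, h'⟩ | ⟨i, h', h'', -⟩ := hf _ h
  · simp at h'
  · simp at h'
  · omega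

end Exponents

/-! ### A nonzero Betti number of an ideal with a block structure -/

section Blocks

variable {σ k : Type*} [Field k] {μ : ℕ → σ →₀ ℕ} {s : ℕ}

lemma linearMap_apply_eq_sum {R : Type*} [CommRing R] {n : ℕ} (f : (Fin n → R) →ₗ[R] R)
    (v : Fin n → R) : f v = ∑ b, v b * f (Pi.single b 1) := by
  have hv : v = ∑ b, v b • Pi.single b (1 : R) := by
    simpa using ((Pi.basisFun R (Fin n)).sum_repr v).symm
  conv_lhs => rw [hv]
  simp only [map_sum, map_smul, smul_eq_mul]

/-- A linear functional with values in `blockIdeal k μ s r r` factors, up to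
`blockIdeal k μ s r (r + 1)`, through multiplication by the monomial with exponent `μ r`; the factor
is obtained by dividing the coefficients of the functional by that monomial. -/
lemma exists_monomial_factor {n r : ℕ}
    (c : (Fin n → MvPolynomial σ k) →ₗ[MvPolynomial σ k] MvPolynomial σ k)
    (hc : ∀ v, c v ∈ blockIdeal k μ s r r) :
    ∃ g : (Fin n → MvPolynomial σ k) →ₗ[MvPolynomial σ k] MvPolynomial σ k,
      (∀ v, c v - monomial (μ r) 1 * g v ∈ blockIdeal k μ s r (r + 1)) ∧
        ∀ b m, coeff m (g (Pi.single b 1)) = coeff (μ r + m) (c (Pi.single b 1)) := by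
  classical
  let g := Fintype.linearCombination (MvPolynomial σ k)
    (fun b => (c (Pi.single b 1)).divMonomial (μ r))
  have hg : ∀ b, g (Pi.single b 1) = (c (Pi.single b 1)).divMonomial (μ r) := fun b => by
    simp [g, Fintype.linearCombination_apply_single]
  refine ⟨g, fun v => ?_, fun b m => by rw [hg, coeff_divMonomial]⟩
  have hlin : c v - monomial (μ r) 1 * g v =
      ∑ b, v b * (c (Pi.single b 1) - monomial (μ r) 1 * g (Pi.single b 1)) := by
    rw [linearMap_apply_eq_sum c, linearMap_apply_eq_sum g, Finset.mul_sum, ← Finset.sum_sub_distrib]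
    exact Finset.sum_congr rfl fun b _ => by ring
  rw [hlin]
  refine Ideal.sum_mem _ fun b _ => Ideal.mul_mem_left _ _ ?_
  have h := divMonomial_add_modMonomial (c (Pi.single b 1)) (μ r)
  rw [hg, sub_eq_iff_eq_add.2 (((add_comm _ _).trans h).symm)]
  exact modMonomial_mem_blockIdeal (hc _)

/-- The two chain maps and the homotopy of the argument, in homological degree `r`. The functional `g`
on `F r` lifts to `S` the component in degree `r` of a chain map from the resolution `F` to the
complex of cyclic modules `S / blockIdeal k μ s r (r + 1)`. The elements `z T` and `z' T` are the
images of the basis elements `e_T` of the Koszul complex in degrees `r` and `r + 1` under a chain map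
to `F`. The homotopy `h` shows that the composite is, in degree `r`, the functional dual to
`e_{0, …, r - 1}`. -/
lemma exists_functional {I : Ideal (MvPolynomial σ k)} {t : ℕ}
    (hsq : ∀ i < s, ∀ v, μ i v ≤ 1)
    (hdisj : ∀ i < s, ∀ j < s, i ≠ j → ∀ v, μ i v = 0 ∨ μ j v = 0)
    (hdeg : ∀ i < s, (μ i).degree = t)
    (hgen : ∀ i < s, monomial (μ i) (1 : k) ∈ I) (hI : I ≤ blockIdeal k μ s 0 0)
    (F : MinimalGradedFreeResolution (σ := σ) (quotientGrading I)) (r : ℕ) (hr : r ≤ s) :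
    ∃ (g : (Fin (F.rank r) → MvPolynomial σ k) →ₗ[MvPolynomial σ k] MvPolynomial σ k)
      (z : Finset ℕ → Fin (F.rank r) → MvPolynomial σ k)
      (z' : Finset ℕ → Fin (F.rank (r + 1)) → MvPolynomial σ k)
      (h : Finset ℕ → MvPolynomial σ k),
      (∀ w, g (F.d r w) ∈ blockIdeal k μ s r r) ∧
      (∀ b m, coeff m (g (Pi.single b 1)) ≠ 0 → m.degree + r * t = F.deg r b) ∧
      (∀ T ⊆ Finset.range s, T.card = r + 1 →
        F.d r (z' T) = koszulBoundary (fun i => monomial (μ i) (1 : k)) z T) ∧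
      ∀ T ⊆ Finset.range s, T.card = r →
        g (z T) - (if T = Finset.range r then 1 else 0) -
          koszulBoundary (fun i => monomial (μ i) (1 : k)) h T ∈ blockIdeal k μ s r r := by
  classical
  induction r with
  | zero =>
    choose p hp hp' using fun b => Submodule.mem_map.1 (F.aug_homogeneous b)
    obtain ⟨z₀, hz₀⟩ := F.aug_surjective (Ideal.Quotient.mk I 1)
    let g := Fintype.linearCombination (MvPolynomial σ k) p
    have hg : ∀ b, g (Pi.single b 1) = p b := fun b => by
      simp [g, Fintype.linearCombination_apply_single]
    have hlift : (Submodule.mkQ I).comp g = F.aug := by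
      refine LinearMap.pi_ext' fun b => LinearMap.ext_ring ?_
      simpa [hg] using hp' b
    have hmk : ∀ v, Ideal.Quotient.mk I (g v) = F.aug v := fun v => LinearMap.congr_fun hlift v
    have hz : ∀ T : Finset ℕ, ∃ y, T ⊆ Finset.range s →
        F.d 0 y = koszulBoundary (fun i => monomial (μ i) (1 : k)) (fun _ => z₀) T := by
      intro T
      by_cases hT : T ⊆ Finset.range s
      · obtain ⟨y, hy⟩ := (F.exact_zero (koszulBoundary (fun i => monomial (μ i) (1 : k))
          (fun _ => z₀) T)).1 (by
            rw [map_koszulBoundary]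
            refine Finset.sum_eq_zero fun i hi => ?_
            rw [hz₀]
            exact Ideal.Quotient.eq_zero_iff_mem.2 (I.mul_mem_right 1
              (I.mul_mem_left _ (hgen i (Finset.mem_range.1 (hT hi))))))
        exact ⟨y, fun _ => hy⟩
      · exact ⟨0, fun h => absurd h hT⟩
    choose z' hz' using hz
    refine ⟨g, fun _ => z₀, z', fun _ => 0, fun w => hI ?_, fun b m hm => ?_,
      fun T hT _ => hz' T hT, fun T hT hT' => hI ?_⟩
    · rw [← Ideal.Quotient.eq_zero_iff_mem, hmk]
      exact (F.exact_zero _).2 ⟨w, rfl⟩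
    · rw [hg] at hm
      rw [zero_mul, add_zero, Finsupp.degree_eq_weight_one]
      exact hp b hm
    · rw [Finset.card_eq_zero] at hT'
      subst hT'
      simp only [Finset.range_zero, if_true, koszulBoundary, Finset.sum_empty, sub_zero]
      rw [← Ideal.Quotient.eq, hmk, hz₀]
  | succ r ih =>
    obtain ⟨g, z, z', h, hg, hghom, hz, hgz⟩ := ih (by omega)
    have hr' : r < s := hr
    obtain ⟨g', hg', hg'coeff⟩ := exists_monomial_factor (g.comp (F.d r)) hg
    let x : ℕ → MvPolynomial σ k := fun i => monomial (μ i) 1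
    let δ : ℕ → Finset ℕ → MvPolynomial σ k := fun r T => if T = Finset.range r then 1 else 0
    let e : Finset ℕ → MvPolynomial σ k := fun T => g (z T) - δ r T - koszulBoundary x h T
    have hsub : ∀ {T : Finset ℕ} {n : ℕ}, T ⊆ Finset.range s → T.card = n + 1 → ∀ i ∈ T,
        T.erase i ⊆ Finset.range s ∧ (T.erase i).card = n := fun hT hT' i hi =>
      ⟨(Finset.erase_subset _ _).trans hT, by rw [Finset.card_erase_of_mem hi, hT']; rfl⟩
    have hz : ∀ T : Finset ℕ, ∃ y, T ⊆ Finset.range s → T.card = r + 2 →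
        F.d (r + 1) y = koszulBoundary x z' T := by
      intro T
      by_cases hT : T ⊆ Finset.range s ∧ T.card = r + 2
      · obtain ⟨y, hy⟩ := (F.exact_succ r (koszulBoundary x z' T)).1 (by
          rw [map_koszulBoundary, koszulBoundary_congr x
            (fun i hi => hz _ (hsub hT.1 hT.2 i hi).1 (hsub hT.1 hT.2 i hi).2)]
          exact koszulBoundary_koszulBoundary x z T)
        exact ⟨y, fun _ _ => hy⟩
      · exact ⟨0, fun h h' => absurd ⟨h, h'⟩ hT⟩
    choose z'' hz'' using hz
    refine ⟨g', z', z'', fun T => (e T).divMonomial (μ r), fun w => ?_, fun b m hm => ?_, hz'',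
      fun T hT hT' => ?_⟩
    · refine mem_blockIdeal_of_monomial_mul_mem hsq hdisj hr' ?_
      have hdd : F.d r (F.d (r + 1) w) = 0 := (F.exact_succ r _).2 ⟨w, rfl⟩
      simpa [hdd] using hg' (F.d (r + 1) w)
    · rw [hg'coeff, LinearMap.comp_apply] at hm
      rw [linearMap_apply_eq_sum, coeff_sum] at hm
      obtain ⟨a, -, ha⟩ := Finset.exists_ne_zero_of_sum_ne_zero hm
      rw [coeff_mul] at ha
      obtain ⟨q, hq, hne⟩ := Finset.exists_ne_zero_of_sum_ne_zero ha
      rw [Finset.HasAntidiagonal.mem_antidiagonal] at hq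
      have h1 := F.d_homogeneous r a b q.1 (left_ne_zero_of_mul hne)
      have h2 := hghom a q.2 (right_ne_zero_of_mul hne)
      have h3 := congrArg Finsupp.degree hq
      rw [map_add, map_add, hdeg r hr'] at h3
      rw [add_mul, one_mul]
      omega
    · refine mem_blockIdeal_of_monomial_mul_mem hsq hdisj hr' ?_
      have h1 := hg' (z' T)
      rw [LinearMap.comp_apply, hz T hT hT', map_koszulBoundary] at h1
      -- The value of `g` on each `z U` is split into four terms; on the second of them the Koszul
      -- boundary vanishes.
      have h2 : koszulBoundary x (fun U => g (z U)) T =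
          koszulBoundary x (δ r) T + x r * koszulBoundary x (fun U => (e U).divMonomial (μ r)) T +
            koszulBoundary x (fun U => (e U).modMonomial (μ r)) T := by
        have h3 : ∀ U, g (z U) = δ r U + (koszulBoundary x h U +
            (x r * (e U).divMonomial (μ r) + (e U).modMonomial (μ r))) := by
          intro U
          rw [divMonomial_add_modMonomial]
          simp only [e]
          ring
        have h4 := map_koszulBoundary (LinearMap.mulLeft (MvPolynomial σ k) (x r)) x
          (fun U => (e U).divMonomial (μ r)) T
        simp only [LinearMap.mulLeft_apply] at h4
        rw [funext h3, koszulBoundary_add, koszulBoundary_add, koszulBoundary_add,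
          koszulBoundary_koszulBoundary, ← h4]
        ring
      have h4 : koszulBoundary x (fun U => (e U).modMonomial (μ r)) T ∈
          blockIdeal k μ s r (r + 1) := koszulBoundary_mem x fun i hi =>
        modMonomial_mem_blockIdeal (hgz _ (hsub hT hT' i hi).1 (hsub hT hT' i hi).2)
      have h5 : koszulBoundary x (δ r) T - x r * δ (r + 1) T ∈ blockIdeal k μ s r (r + 1) :=
        koszulBoundary_indicator_sub_mem fun i hi hi' =>
          monomial_mem_blockIdeal μ hi' (Finset.mem_range.1 (hT hi))
      rw [h2] at h1
      have h6 := (blockIdeal k μ s r (r + 1)).sub_mem (Ideal.add_mem _ h5 h4) h1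
      convert h6 using 1
      simp only [x, δ]
      ring

/-- Let `y ^ μ 0, …, y ^ μ (s - 1)` be pairwise coprime squarefree monomials of degree `t`. If they
lie in an ideal `I`, and every monomial of an element of `I` is divisible by one of them, by a square
or by a variable that divides none of them, then the `s`-th module of a minimal graded free
resolution of `S / I` has a basis element of degree `s * t`. -/
theorem exists_deg_eq {I : Ideal (MvPolynomial σ k)} {t : ℕ} (ht : t ≠ 0)
    (hsq : ∀ i < s, ∀ v, μ i v ≤ 1)
    (hdisj : ∀ i < s, ∀ j < s, i ≠ j → ∀ v, μ i v = 0 ∨ μ j v = 0)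
    (hdeg : ∀ i < s, (μ i).degree = t)
    (hgen : ∀ i < s, monomial (μ i) (1 : k) ∈ I) (hI : I ≤ blockIdeal k μ s 0 0)
    (F : MinimalGradedFreeResolution (σ := σ) (quotientGrading I)) :
    ∃ b, F.deg s b = s * t := by
  classical
  obtain ⟨g, z, -, h, -, hghom, -, hgz⟩ := exists_functional hsq hdisj hdeg hgen hI F s le_rfl
  have h1 := constantCoeff_eq_zero_of_mem_blockIdeal
    (hgz (Finset.range s) subset_rfl (Finset.card_range s))
  -- The Koszul boundary vanishes modulo the variables, so the functional is a unit on the top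
  -- element.
  have h2 : constantCoeff (koszulBoundary (fun i => monomial (μ i) (1 : k)) h
      (Finset.range s)) = 0 := by
    rw [koszulBoundary, map_sum]
    refine Finset.sum_eq_zero fun i hi => ?_
    have h0 : constantCoeff (monomial (μ i) (1 : k)) = 0 := by
      rw [constantCoeff_monomial, if_neg]
      rintro h0
      exact ht (by rw [← hdeg i (Finset.mem_range.1 hi), h0, map_zero])
    rw [smul_eq_mul, map_mul, map_mul, h0, mul_zero, zero_mul]
  rw [map_sub, map_sub, if_pos rfl, map_one, h2, sub_zero, sub_eq_zero] at h1
  rw [linearMap_apply_eq_sum, map_sum] at h1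
  obtain ⟨b, -, hb⟩ := Finset.exists_ne_zero_of_sum_ne_zero (h1.trans_ne one_ne_zero)
  rw [map_mul] at hb
  refine ⟨b, ?_⟩
  have := hghom b 0 (by rw [← constantCoeff_eq]; exact right_ne_zero_of_mul hb)
  simpa using this.symm

end Blocks

/-! ### Path ideals -/

section Paths

variable {k P : Type*} [Field k]

/-- The exponent of the monomial of a list of variables. -/
noncomputable def listExponent (l : List P) : P →₀ ℕ :=
  (l.map fun v => Finsupp.single v 1).sum

lemma listExponent_apply [DecidableEq P] (l : List P) (v : P) : listExponent l v = l.count v := by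
  induction l with
  | nil => simp [listExponent]
  | cons a l ih =>
    rw [listExponent] at ih ⊢
    rw [List.map_cons, List.sum_cons, Finsupp.add_apply, ih, List.count_cons, Finsupp.single_apply]
    simp only [beq_iff_eq]
    exact add_comm _ _

lemma degree_listExponent (l : List P) : (listExponent l).degree = l.length := by
  induction l with
  | nil => simp [listExponent]
  | cons a l ih =>
    rw [listExponent] at ih ⊢
    rw [List.map_cons, List.sum_cons, map_add, ih, Finsupp.degree_single, List.length_cons,
      add_comm]

lemma prod_map_X_eq_monomial (l : List P) :
    (l.map X).prod = (monomial (listExponent l) 1 : MvPolynomial P k) := by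
  induction l with
  | nil => simp [listExponent]
  | cons a l ih =>
    rw [List.map_cons, List.prod_cons, ih, X, monomial_mul, one_mul]
    rfl

variable [PartialOrder P]

lemma IsPath.nodup {t : ℕ} {l : List P} (hl : IsPath t l) : l.Nodup :=
  ((hl.1.imp fun _ _ h => h.lt).pairwise).imp fun h => h.ne

lemma monomial_mem_pathIdeal {t : ℕ} {l : List P} (hl : IsPath t l) :
    monomial (listExponent l) (1 : k) ∈ pathIdeal k P t :=
  Ideal.subset_span ⟨l, hl, (prod_map_X_eq_monomial l).symm⟩

lemma homogeneousComponent_mem_pathIdeal {t : ℕ} {f : MvPolynomial P k}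
    (hf : f ∈ pathIdeal k P t) (j : ℕ) : homogeneousComponent j f ∈ pathIdeal k P t := by
  let : GradedAlgebra (homogeneousSubmodule P k) := gradedAlgebra
  refine (mem_iff_homogeneousComponent_mem (Ideal.homogeneous_span _ _ ?_) f).1 hf j
  rintro _ ⟨l, hl, rfl⟩
  refine ⟨t, ?_⟩
  rw [prod_map_X_eq_monomial, mem_homogeneousSubmodule]
  exact isHomogeneous_monomial _ ((degree_listExponent l).trans hl.2)

lemma constantCoeff_eq_zero_of_mem_pathIdeal {t : ℕ} (ht : t ≠ 0) {f : MvPolynomial P k}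
    (hf : f ∈ pathIdeal k P t) : constantCoeff f = 0 := by
  have hle : pathIdeal k P t ≤ RingHom.ker (constantCoeff (σ := P) (R := k)) := by
    classical
    refine Ideal.span_le.2 ?_
    rintro _ ⟨l, hl, rfl⟩
    rw [SetLike.mem_coe, RingHom.mem_ker, prod_map_X_eq_monomial, constantCoeff_monomial, if_neg]
    intro h
    have := degree_listExponent l
    rw [h, map_zero, hl.2] at this
    exact ht this.symm
  exact hle hf

/-- Let `L 0, …, L (s - 1)` enumerate an admissible set of paths. Since every path inside the union
of the `L i` is one of them, the path ideal is contained in the ideal generated by the monomials of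
the `L i`, the remaining variables, and the squares of all variables. -/
lemma pathIdeal_le_blockIdeal {t s : ℕ} {L : ℕ → List P}
    (hL : ∀ l, IsPath t l → (∀ x ∈ l, ∃ i < s, x ∈ L i) → ∃ i < s, L i = l) :
    pathIdeal k P t ≤ blockIdeal k (fun i => listExponent (L i)) s 0 0 := by
  classical
  refine Ideal.span_le.2 ?_
  rintro _ ⟨l, hl, rfl⟩
  rw [prod_map_X_eq_monomial]
  refine monomial_mem_exponentIdeal ?_ 1
  by_cases h : ∀ x ∈ l, ∃ i < s, x ∈ L i
  · obtain ⟨i, hi, rfl⟩ := hL l hl h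
    exact Or.inr (Or.inr ⟨i, Nat.zero_le _, hi, le_rfl⟩)
  · push Not at h
    obtain ⟨v, hv, hv'⟩ := h
    refine Or.inl ⟨v, fun i _ hi => ?_, ?_⟩
    · rw [listExponent_apply, List.count_eq_zero]
      exact hv' i hi
    · rw [listExponent_apply]
      exact List.one_le_count_iff.2 hv

/-- A finite set is enumerated by an initial segment of the natural numbers. -/
lemma exists_enumeration {α : Type*} [Inhabited α] (A : Finset α) :
    ∃ L : ℕ → α, (∀ i < A.card, L i ∈ A) ∧ (∀ a ∈ A, ∃ i < A.card, L i = a) ∧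
      ∀ i < A.card, ∀ j < A.card, L i = L j → i = j := by
  refine ⟨fun i => if h : i < A.card then (A.equivFin.symm ⟨i, h⟩ : α) else default, ?_, ?_, ?_⟩
  · intro i hi
    simp [hi]
  · intro a ha
    exact ⟨A.equivFin ⟨a, ha⟩, Fin.is_lt _, by simp⟩
  · intro i hi j hj h
    simpa [hi, hj] using h

/-- The Betti number in homological degree `s` and internal degree `s * t` given by an admissible
set of `s` paths is nonzero. -/
theorem gradedBetti_pathIdeal_ne_zero [Finite P] {t : ℕ} (ht : t ≠ 0) {A : Finset (List P)}
    (hA : IsAdmissible t A) :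
    gradedBetti P (quotientGrading (pathIdeal k P t)) A.card (A.card * t) ≠ 0 := by
  classical
  obtain ⟨F⟩ := exists_minimalGradedFreeResolution (I := pathIdeal k P t)
    (fun f hf j => homogeneousComponent_mem_pathIdeal hf j)
    (fun f hf => constantCoeff_eq_zero_of_mem_pathIdeal ht hf)
  obtain ⟨L, hLA, hL, hLinj⟩ := exists_enumeration A
  obtain ⟨hpath, hdisj, hunion⟩ := hA
  obtain ⟨b, hb⟩ := exists_deg_eq (μ := fun i => listExponent (L i)) (s := A.card) ht
    (fun i hi v => by
      rw [listExponent_apply]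
      exact List.nodup_iff_count_le_one.1 (hpath _ (hLA i hi)).nodup v)
    (fun i hi j hj hij v => by
      simp only [listExponent_apply, List.count_eq_zero]
      by_contra! h
      exact hdisj (hLA i hi) (hLA j hj) (fun h' => hij (hLinj i hi j hj h')) h.1 h.2)
    (fun i hi => (degree_listExponent _).trans (hpath _ (hLA i hi)).2)
    (fun i hi => monomial_mem_pathIdeal (hpath _ (hLA i hi)))
    (pathIdeal_le_blockIdeal fun l hl h => hL l (hunion l hl fun x hx =>
      let ⟨i, hi, hxi⟩ := h x hx
      ⟨L i, hLA i hi, hxi⟩)) F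
  refine ne_of_gt (lt_of_lt_of_le ?_ (le_iSup _ F))
  exact pos_iff_ne_zero.2 (Set.encard_ne_zero.2 ⟨b, hb⟩)

end Paths

end PosetPathIdeal

theorem mainTheorem7 {k P : Type*} [Field k] [PartialOrder P] [Finite P] (t : ℕ) (ht : 2 ≤ t) :
    (((PosetPathIdeal.maxPaths P t : ℝ) * ((t : ℝ) - 1) : ℝ) : EReal) ≤
      PosetPathIdeal.regQuotient (PosetPathIdeal.pathIdeal k P t) := by
  obtain ⟨A, hA, hcard⟩ := (PosetPathIdeal.isGreatest_maxPaths P t (by omega)).1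
  rw [← hcard]
  refine le_sSup ⟨A.card, A.card * t,
    PosetPathIdeal.gradedBetti_pathIdeal_ne_zero (by omega) hA, ?_⟩
  congr 1
  push_cast
  ring
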